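/- Let $S$ be a set of vertices of a finite connected graph $G$. The Steiner distance $d(S)$ is the minimum number of edges of a connected subgraph of $G$ containing all the vertices of $S$, and the average $k$-Steiner distance of $G$ is $$\mu_k(G)=\binom{|V(G)|}{k}^{-1}\sum_{S\subseteq V(G),\ |S|=k} d(S).$$ The $n$-cube $Q_n$ has as vertices the binary strings of length $n$, two of them being adjacent if they differ in precisely one place. The Fibonacci cube $\Gamma_n$ is the subgraph of $Q_n$ induced by the strings $b_1b_2\ldots b_n$ with $b_ib_{i+1}=0$ for $1\le i<n$, and the Lucas cube $\Lambda_n$ is the subgraph of $Q_n$ induced by those of these strings that also satisfy $b_1b_n=0$. Then $$\lim_{n\to\infty}\frac{\mu_3(\Gamma_n)}{n}=\lim_{n\to\infty}\frac{\mu_3(\Lambda_n)}{n}=\frac35 .$$ -/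

import Mathlib

open Filter Topology

/-- The Steiner distance of a set `S` of vertices of a connected finite graph `G`: the minimum
number of edges of a connected subgraph of `G` that contains all the vertices of `S`. -/
noncomputable def steinerDist {V : Type*} (G : SimpleGraph V) (S : Set V) : ℕ :=
  sInf {m : ℕ | ∃ H : G.Subgraph, H.Connected ∧ S ⊆ H.verts ∧ H.edgeSet.ncard = m}

/-- The average `k`-Steiner distance `μ_k(G)`: the average of the Steiner distances of all
`k`-element sets of vertices. -/
noncomputable def avgSteinerDist {V : Type*} [Fintype V] (k : ℕ) (G : SimpleGraph V) : ℝ :=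
  (((Fintype.card V).choose k : ℕ) : ℝ)⁻¹ *
    ∑ S ∈ (Finset.univ : Finset V).powersetCard k, (steinerDist G (S : Set V) : ℝ)

/-- The `n`-cube `Q_n`: binary strings of length `n`, two of them being adjacent if they differ in
precisely one place. -/
def nCube (n : ℕ) : SimpleGraph (Fin n → Bool) where
  Adj b c := hammingDist b c = 1
  symm := ⟨fun b c h => by rw [hammingDist_comm]; exact h⟩
  loopless := ⟨fun b h => by simp at h⟩

/-- A Fibonacci string is a binary string without two consecutive ones. -/
def IsFibonacciString {n : ℕ} (b : Fin n → Bool) : Prop :=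
  ∀ i j : Fin n, (i : ℕ) + 1 = (j : ℕ) → ¬ (b i = true ∧ b j = true)

/-- A Lucas string is a Fibonacci string whose first and last entries are not both one. -/
def IsLucasString {n : ℕ} (b : Fin n → Bool) : Prop :=
  IsFibonacciString b ∧
    ∀ i j : Fin n, (i : ℕ) = 0 → (j : ℕ) + 1 = n → ¬ (b i = true ∧ b j = true)

instance {n : ℕ} : DecidablePred (IsFibonacciString (n := n)) := fun b => by
  unfold IsFibonacciString; infer_instance

instance {n : ℕ} : DecidablePred (IsLucasString (n := n)) := fun b => by
  unfold IsLucasString; infer_instance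

/-- The Fibonacci cube `Γ_n`: the subgraph of `Q_n` induced by the Fibonacci strings. -/
def fibonacciCube (n : ℕ) : SimpleGraph {b : Fin n → Bool // IsFibonacciString b} :=
  (nCube n).induce {b | IsFibonacciString b}

/-- The Lucas cube `Λ_n`: the subgraph of `Q_n` induced by the Lucas strings. -/
def lucasCube (n : ℕ) : SimpleGraph {b : Fin n → Bool // IsLucasString b} :=
  (nCube n).induce {b | IsLucasString b}

theorem nCube_induce_connected {n : ℕ} (s : Set (Fin n → Bool)) (h0 : (fun _ => false) ∈ s)
    (hs : ∀ b ∈ s, ∀ i, Function.update b i false ∈ s) : ((nCube n).induce s).Connected := by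
  have key : ∀ m : ℕ, ∀ b : s, (Finset.univ.filter fun i => b.1 i = true).card = m →
      ((nCube n).induce s).Reachable b ⟨_, h0⟩ := by
    intro m
    induction m with
    | zero =>
      intro b hb
      have hbz : b = ⟨_, h0⟩ := by
        apply Subtype.ext
        funext i
        have := (Finset.filter_eq_empty_iff.mp (Finset.card_eq_zero.mp hb)) (Finset.mem_univ i)
        simpa using this
      rw [hbz]
    | succ m ih =>
      intro b hb
      obtain ⟨i, hi⟩ := Finset.card_pos.mp (by omega :
        0 < (Finset.univ.filter fun i => b.1 i = true).card)
      have hbi : b.1 i = true := by simpa using hi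
      have hfil : (Finset.univ.filter fun j => Function.update b.1 i false j = true)
          = (Finset.univ.filter fun j => b.1 j = true).erase i := by
        ext j
        by_cases hj : j = i
        · subst hj; simp
        · simp [hj]
      have hr := ih ⟨Function.update b.1 i false, hs _ b.2 i⟩ (by
        show (Finset.univ.filter fun j => Function.update b.1 i false j = true).card = m
        rw [hfil, Finset.card_erase_of_mem hi, hb]; rfl)
      refine SimpleGraph.Reachable.trans (SimpleGraph.Adj.reachable ?_) hr
      show hammingDist b.1 (Function.update b.1 i false) = 1
      unfold hammingDist
      rw [Finset.card_eq_one]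
      refine ⟨i, ?_⟩
      ext j
      by_cases hj : j = i
      · subst hj; simp [hbi]
      · simp [hj]
  exact (SimpleGraph.connected_iff _).mpr
    ⟨fun b c => (key _ b rfl).trans (key _ c rfl).symm, ⟨⟨_, h0⟩⟩⟩

theorem update_false_true {n : ℕ} {b : Fin n → Bool} {i j : Fin n}
    (h : Function.update b i false j = true) : b j = true := by
  by_cases hj : j = i
  · subst hj; simp at h
  · simpa [hj] using h

/-- Fibonacci cubes are connected, so Steiner distances in them are defined. -/
theorem fibonacciCube_connected (n : ℕ) : (fibonacciCube n).Connected :=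
  nCube_induce_connected {b | IsFibonacciString b} (fun _ _ _ h => by simp at h)
    fun _ hb _ j k hjk h => hb j k hjk ⟨update_false_true h.1, update_false_true h.2⟩

/-- Lucas cubes are connected, so Steiner distances in them are defined. -/
theorem lucasCube_connected (n : ℕ) : (lucasCube n).Connected :=
  nCube_induce_connected {b | IsLucasString b}
    ⟨fun _ _ _ h => by simp at h, fun _ _ _ _ h => by simp at h⟩
    fun _ hb _ =>
      ⟨fun j k hjk h => hb.1 j k hjk ⟨update_false_true h.1, update_false_true h.2⟩,
        fun j k hj hk h => hb.2 j k hj hk ⟨update_false_true h.1, update_false_true h.2⟩⟩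

/-! Fibonacci and Lucas strings are closed under switching off ones and under coordinate-wise
majority. The median of three vertices is then a vertex, and geodesics from it to the three form a
Steiner tree, so the Steiner distance of a triple is the number of coordinates on which it is not
constant (`steinerDist_triple`). Averaging can therefore be done coordinate by coordinate. If among
`N` strings `a i` have a one and `z i` a zero in position `i`, then `a i * z i * (N - 2) / 2`
triples disagree there, whence `μ₃ = 3 ∑ a i * z i / (N (N - 1))` (`avgSteinerDist_three`). The
counts are products of Fibonacci numbers in the Fibonacci cube and, by rotation, independent of `i`
in the Lucas cube. By Binet's formula `a i * z i / N²` tends to `1/5`: at every position for Lucas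
strings, on average over positions for Fibonacci strings, where the boundary effect decays
geometrically. Each coordinate thus contributes about `3/5`. -/

/-! ### Steiner distance of three binary strings -/

theorem hammingDist_eq_sum {n : ℕ} (b c : Fin n → Bool) :
    hammingDist b c = ∑ i, if b i ≠ c i then 1 else 0 := by
  simp [hammingDist, Finset.card_filter]

/-- A graph on a set of binary strings is connected along descending chains: below a string `x`
every string `y` is reached by switching off the surplus ones. -/
theorem exists_walk_of_le {n : ℕ} {P : (Fin n → Bool) → Prop}
    (hP : ∀ b c : Fin n → Bool, P b → (∀ i, c i = true → b i = true) → P c)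
    {G : SimpleGraph {b // P b}} (hG : ∀ x y, G.Adj x y ↔ hammingDist x.1 y.1 = 1)
    (x y : {b // P b}) (hyx : ∀ i, y.1 i = true → x.1 i = true) :
    ∃ p : G.Walk x y, p.length = hammingDist x.1 y.1 := by
  induction h : hammingDist x.1 y.1 generalizing x with
  | zero =>
    obtain rfl : x = y := Subtype.ext (hammingDist_eq_zero.mp h)
    exact ⟨.nil, rfl⟩
  | succ m ih =>
    have hne : x.1 ≠ y.1 := by
      intro he
      rw [he, hammingDist_self] at h
      omega
    obtain ⟨i, hi⟩ := Function.ne_iff.mp hne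
    have hy : y.1 i = false := by
      by_contra hy
      have hy : y.1 i = true := by simpa using hy
      exact hi (by rw [hy, hyx i hy])
    have hx : x.1 i = true := by
      by_contra hx
      exact hi (by rw [hy]; simpa using hx)
    let z : {b // P b} := ⟨Function.update x.1 i false,
      hP _ _ x.2 fun _ hj => update_false_true hj⟩
    have hxz : hammingDist x.1 z.1 = 1 := by
      unfold hammingDist
      rw [Finset.card_eq_one]
      refine ⟨i, ?_⟩
      ext j
      by_cases hj : j = i
      · subst hj; simp [z, hx]
      · simp [z, hj]
    have hsum : hammingDist x.1 y.1 = hammingDist x.1 z.1 + hammingDist z.1 y.1 := by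
      simp only [hammingDist_eq_sum, ← Finset.sum_add_distrib]
      refine Finset.sum_congr rfl fun j _ => ?_
      by_cases hj : j = i
      · subst hj; simp [z, hx, hy]
      · simp [z, hj]
    obtain ⟨p, hp⟩ := ih z (fun j hj => by
      by_cases hji : j = i
      · subst hji; simp [hy] at hj
      · simpa [z, hji] using hyx j hj) (by omega)
    exact ⟨.cons ((hG x z).mpr hxz) p, by simp [hp]⟩

/-- In a set of binary strings closed under switching off ones, any two strings are joined by a
walk whose length is their Hamming distance. -/
theorem exists_walk_length_eq_hammingDist {n : ℕ} {P : (Fin n → Bool) → Prop}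
    (hP : ∀ b c : Fin n → Bool, P b → (∀ i, c i = true → b i = true) → P c)
    {G : SimpleGraph {b // P b}} (hG : ∀ x y, G.Adj x y ↔ hammingDist x.1 y.1 = 1)
    (x y : {b // P b}) :
    ∃ p : G.Walk x y, p.length = hammingDist x.1 y.1 := by
  -- Descend from both strings to their meet; each coordinate where they differ is switched in
  -- exactly one of the two descents.
  let z : {b // P b} := ⟨fun i => x.1 i && y.1 i, hP _ _ x.2 fun i hi => by simp_all⟩
  obtain ⟨p, hp⟩ := exists_walk_of_le hP hG x z (fun i hi => by simp_all [z])
  obtain ⟨q, hq⟩ := exists_walk_of_le hP hG y z (fun i hi => by simp_all [z])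
  refine ⟨p.append q.reverse, ?_⟩
  rw [SimpleGraph.Walk.length_append, SimpleGraph.Walk.length_reverse, hp, hq]
  simp only [hammingDist_eq_sum, ← Finset.sum_add_distrib]
  refine Finset.sum_congr rfl fun j _ => ?_
  cases hx : x.1 j <;> cases hy : y.1 j <;> simp [z, hx, hy]

theorem ncard_edgeSet_toSubgraph_le {V : Type*} {G : SimpleGraph V} {x y : V}
    (p : G.Walk x y) : p.toSubgraph.edgeSet.ncard ≤ p.length := by
  classical
  have h : p.toSubgraph.edgeSet = (p.edges.toFinset : Set (Sym2 V)) := by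
    ext e
    simp
  rw [h, Set.ncard_coe_finset, ← SimpleGraph.Walk.length_edges]
  exact List.toFinset_card_le _

/-- Each coordinate in which two vertices of a connected subgraph of a cube differ is switched
along some edge of the subgraph. -/
theorem exists_adj_ne_of_connected {V : Type*} {G : SimpleGraph V} {H : G.Subgraph}
    (hH : H.Connected) (f : V → Bool) {x y : V} (hx : x ∈ H.verts) (hy : y ∈ H.verts)
    (hxy : f x ≠ f y) : ∃ u v, H.Adj u v ∧ f u ≠ f v := by
  by_contra! hc
  obtain ⟨p⟩ := hH.coe.preconnected ⟨x, hx⟩ ⟨y, hy⟩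
  have key : ∀ {a b : H.verts} (_ : H.coe.Walk a b), f a = f b := by
    intro a b p
    induction p with
    | nil => rfl
    | cons h _ ih => exact (hc _ _ h).trans ih
  exact hxy (key p)

/-- An edge of a cube switches only one coordinate, so edges chosen to switch different coordinates
are different. -/
theorem card_le_ncard_edgeSet {n : ℕ} {P : (Fin n → Bool) → Prop}
    {G : SimpleGraph {b // P b}} (hG : ∀ x y, G.Adj x y ↔ hammingDist x.1 y.1 = 1)
    {H : G.Subgraph} (hH : H.Connected) (D : Finset (Fin n))
    (hD : ∀ i ∈ D, ∃ x ∈ H.verts, ∃ y ∈ H.verts, x.1 i ≠ y.1 i) :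
    D.card ≤ H.edgeSet.ncard := by
  classical
  have hfin : Finite {b // P b} := inferInstance
  have h : ∀ i : D, ∃ u v, H.Adj u v ∧ u.1 i ≠ v.1 i := by
    intro i
    obtain ⟨x, hx, y, hy, hxy⟩ := hD i i.2
    exact exists_adj_ne_of_connected hH (fun b => b.1 i) hx hy hxy
  choose u v huv hne using h
  have hinj : Function.Injective fun i : D => (⟨s(u i, v i), huv i⟩ : H.edgeSet) := by
    intro i j hij
    have hij : s(u i, v i) = s(u j, v j) := congrArg Subtype.val hij
    have h1 := (hG _ _).mp (huv i).adj_sub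
    obtain ⟨k, hk⟩ := Finset.card_eq_one.mp h1
    have hik : (i : Fin n) = k := by
      rw [← Finset.mem_singleton, ← hk]
      simpa using hne i
    have hjk : (j : Fin n) = k := by
      rw [← Finset.mem_singleton, ← hk]
      have := hne j
      rcases Sym2.eq_iff.mp hij with ⟨e1, e2⟩ | ⟨e1, e2⟩
      · rw [e1, e2]; simpa using this
      · rw [e1, e2]; simpa using this.symm
    exact Subtype.ext (hik.trans hjk.symm)
  have := Nat.card_le_card_of_injective _ hinj
  rwa [Nat.card_eq_fintype_card, Fintype.card_coe, Nat.card_coe_set_eq] at this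

/-- The coordinate-wise majority of three binary strings. -/
def majority {n : ℕ} (b c d : Fin n → Bool) : Fin n → Bool :=
  fun i => (b i && c i) || (b i && d i) || (c i && d i)

/-- The Steiner distance of three binary strings, in a set of strings closed under switching off
ones and under majorities, is the number of coordinates in which they do not all agree. -/
theorem steinerDist_triple {n : ℕ} {P : (Fin n → Bool) → Prop}
    (hP : ∀ b c : Fin n → Bool, P b → (∀ i, c i = true → b i = true) → P c)
    (hM : ∀ b c d, P b → P c → P d → P (majority b c d))
    {G : SimpleGraph {b // P b}} (hG : ∀ x y, G.Adj x y ↔ hammingDist x.1 y.1 = 1)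
    (x y z : {b // P b}) :
    steinerDist G {x, y, z} =
      (Finset.univ.filter fun i => ¬ (x.1 i = y.1 i ∧ x.1 i = z.1 i)).card := by
  set D := Finset.univ.filter fun i => ¬ (x.1 i = y.1 i ∧ x.1 i = z.1 i) with hDdef
  -- The Steiner point. Where the three strings disagree exactly one of them differs from the
  -- majority, so the three distances to `m` add up to `D.card`.
  let m : {b // P b} := ⟨majority x.1 y.1 z.1, hM _ _ _ x.2 y.2 z.2⟩
  obtain ⟨p, hp⟩ := exists_walk_length_eq_hammingDist hP hG x m
  obtain ⟨q, hq⟩ := exists_walk_length_eq_hammingDist hP hG y m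
  obtain ⟨r, hr⟩ := exists_walk_length_eq_hammingDist hP hG z m
  have hsum : hammingDist x.1 m.1 + hammingDist y.1 m.1 + hammingDist z.1 m.1 = D.card := by
    simp only [hammingDist_eq_sum, ← Finset.sum_add_distrib, hDdef, Finset.card_filter]
    refine Finset.sum_congr rfl fun j _ => ?_
    cases hx : x.1 j <;> cases hy : y.1 j <;> cases hz : z.1 j <;>
      simp [m, majority, hx, hy, hz]
  let H := p.toSubgraph ⊔ q.toSubgraph ⊔ r.toSubgraph
  have hHc : H.Connected := by
    refine SimpleGraph.Subgraph.connected_sup (SimpleGraph.Subgraph.connected_sup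
      p.toSubgraph_connected.preconnected q.toSubgraph_connected.preconnected
      ⟨m, ?_⟩).preconnected r.toSubgraph_connected.preconnected ⟨m, ?_⟩ <;> simp
  have hHS : ({x, y, z} : Set {b // P b}) ⊆ H.verts := by
    intro a ha
    rcases ha with rfl | rfl | rfl <;> simp [H]
  have hHe : H.edgeSet.ncard ≤ D.card := by
    have h1 : H.edgeSet = p.toSubgraph.edgeSet ∪ q.toSubgraph.edgeSet ∪ r.toSubgraph.edgeSet := by
      simp [H]
    rw [h1]
    have h2 := Set.ncard_union_le (p.toSubgraph.edgeSet ∪ q.toSubgraph.edgeSet)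
      r.toSubgraph.edgeSet
    have h3 := Set.ncard_union_le p.toSubgraph.edgeSet q.toSubgraph.edgeSet
    have h4 := ncard_edgeSet_toSubgraph_le p
    have h5 := ncard_edgeSet_toSubgraph_le q
    have h6 := ncard_edgeSet_toSubgraph_le r
    omega
  have hle : steinerDist G {x, y, z} ≤ H.edgeSet.ncard := Nat.sInf_le ⟨H, hHc, hHS, rfl⟩
  refine le_antisymm (hle.trans hHe) ?_
  unfold steinerDist
  refine le_csInf (Set.nonempty_of_mem (x := H.edgeSet.ncard) ⟨H, hHc, hHS, rfl⟩) ?_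
  rintro _ ⟨K, hK, hKS, rfl⟩
  refine card_le_ncard_edgeSet hG hK D fun i hi => ?_
  have hx : x ∈ K.verts := hKS (by simp)
  have hi : ¬ (x.1 i = y.1 i ∧ x.1 i = z.1 i) := by simpa [hDdef] using hi
  by_cases h : x.1 i = y.1 i
  · exact ⟨x, hx, z, hKS (by simp), fun h' => hi ⟨h, h'⟩⟩
  · exact ⟨x, hx, y, hKS (by simp), h⟩

/-! ### Averaging over triples, one coordinate at a time -/

/-- The number of triples of elements on which a Boolean function is not constant. -/
theorem card_nonconstant_triples {V : Type*} [Fintype V] (f : V → Bool) (a z : ℕ)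
    (ha : Fintype.card {v // f v = true} = a) (hz : Fintype.card {v // f v = false} = z)
    [DecidablePred fun S : Finset V => ¬ ∀ x ∈ S, ∀ y ∈ S, f x = f y] :
    (((Finset.univ : Finset V).powersetCard 3).filter
      fun S => ¬ ∀ x ∈ S, ∀ y ∈ S, f x = f y).card + a.choose 3 + z.choose 3
      = (a + z).choose 3 := by
  classical
  set A := Finset.univ.filter fun v => f v = true
  set Z := Finset.univ.filter fun v => f v = false
  have hA : A.card = a := by rw [← ha, Fintype.card_subtype]
  have hZ : Z.card = z := by rw [← hz, Fintype.card_subtype]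
  have hcard : Fintype.card V = a + z := by
    rw [← hA, ← hZ, ← Finset.card_univ,
      ← Finset.card_filter_add_card_filter_not (s := Finset.univ) fun v => f v = true]
    simp [A, Z]
  have hdisj : Disjoint (A.powersetCard 3) (Z.powersetCard 3) := by
    rw [Finset.disjoint_left]
    intro S hSA hSZ
    rw [Finset.mem_powersetCard] at hSA hSZ
    obtain ⟨v, hv⟩ : S.Nonempty := Finset.card_pos.mp (by omega)
    have h1 := hSA.1 hv
    have h2 := hSZ.1 hv
    simp [A, Z] at h1 h2
    simp [h1] at h2
  have hconst : ((Finset.univ : Finset V).powersetCard 3).filter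
      (fun S => ∀ x ∈ S, ∀ y ∈ S, f x = f y) = A.powersetCard 3 ∪ Z.powersetCard 3 := by
    ext S
    simp only [Finset.mem_filter, Finset.mem_powersetCard, Finset.mem_union, Finset.subset_univ,
      true_and]
    constructor
    · rintro ⟨h3, hS⟩
      obtain ⟨v, hv⟩ : S.Nonempty := Finset.card_pos.mp (by omega)
      cases hfv : f v
      · exact Or.inr ⟨fun w hw => by simp [Z, hS w hw v hv, hfv], h3⟩
      · exact Or.inl ⟨fun w hw => by simp [A, hS w hw v hv, hfv], h3⟩
    · rintro (⟨hS, h3⟩ | ⟨hS, h3⟩)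
      · refine ⟨h3, fun x hx y hy => ?_⟩
        have h1 := hS hx
        have h2 := hS hy
        simp [A] at h1 h2
        rw [h1, h2]
      · refine ⟨h3, fun x hx y hy => ?_⟩
        have h1 := hS hx
        have h2 := hS hy
        simp [Z] at h1 h2
        rw [h1, h2]
  have htot := Finset.card_filter_add_card_filter_not
    (s := (Finset.univ : Finset V).powersetCard 3) (fun S => ∀ x ∈ S, ∀ y ∈ S, f x = f y)
  rw [hconst, Finset.card_union_of_disjoint hdisj, Finset.card_powersetCard,
    Finset.card_powersetCard, Finset.card_powersetCard, Finset.card_univ, hA, hZ, hcard,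
    add_comm, ← add_assoc] at htot
  convert htot

theorem cast_choose_three (m : ℕ) :
    ((m.choose 3 : ℕ) : ℝ) = (m : ℝ) * (m - 1) * (m - 2) / 6 := by
  induction m with
  | zero => simp
  | succ m ih =>
    rw [Nat.choose_succ_succ' m 2, Nat.cast_add, ih, Nat.cast_choose_two]
    push_cast
    ring

theorem card_true_add_card_false {n : ℕ} {P : (Fin n → Bool) → Prop} [DecidablePred P]
    (i : Fin n) :
    Fintype.card {b : {b // P b} // b.1 i = true} + Fintype.card {b : {b // P b} // b.1 i = false}
      = Fintype.card {b // P b} := by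
  rw [Fintype.card_subtype, Fintype.card_subtype, ← Finset.card_univ,
    ← Finset.card_filter_add_card_filter_not (s := Finset.univ)
      fun b : {b // P b} => b.1 i = true]
  simp

/-- The average 3-Steiner distance in a set of binary strings closed under switching off ones and
under majorities, in terms of the numbers of ones and zeros in each coordinate. -/
theorem avgSteinerDist_three {n : ℕ} {P : (Fin n → Bool) → Prop} [DecidablePred P]
    (hP : ∀ b c : Fin n → Bool, P b → (∀ i, c i = true → b i = true) → P c)
    (hM : ∀ b c d, P b → P c → P d → P (majority b c d))
    {G : SimpleGraph {b // P b}} (hG : ∀ x y, G.Adj x y ↔ hammingDist x.1 y.1 = 1)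
    {N : ℕ} (hN : Fintype.card {b // P b} = N) (h3 : 3 ≤ N) (a z : Fin n → ℕ)
    (ha : ∀ i, Fintype.card {b : {b // P b} // b.1 i = true} = a i)
    (hz : ∀ i, Fintype.card {b : {b // P b} // b.1 i = false} = z i) :
    avgSteinerDist 3 G = 3 * (∑ i, (a i : ℝ) * z i) / (N * (N - 1)) := by
  classical
  have hst : ∀ S ∈ (Finset.univ : Finset {b // P b}).powersetCard 3,
      (steinerDist G (S : Set {b // P b}) : ℝ) =
        ∑ i, if ¬ ∀ x ∈ S, ∀ y ∈ S, x.1 i = y.1 i then 1 else 0 := by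
    intro S hS
    obtain ⟨x, y, w, -, -, -, rfl⟩ := Finset.card_eq_three.mp (Finset.mem_powersetCard.mp hS).2
    have := steinerDist_triple hP hM hG x y w
    rw [Finset.coe_insert, Finset.coe_insert, Finset.coe_singleton, this, Finset.card_filter]
    push_cast
    refine Finset.sum_congr rfl fun i _ => ?_
    congr 1
    simp only [Finset.mem_insert, Finset.mem_singleton, forall_eq_or_imp, forall_eq, eq_iff_iff]
    cases x.1 i <;> cases y.1 i <;> cases w.1 i <;> simp
  have haz : ∀ i, a i + z i = N := by
    intro i
    rw [← hN, ← ha, ← hz, card_true_add_card_false]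
  -- With `a + z = N`, the difference `C(N,3) - C(a,3) - C(z,3)` equals `a z (N - 2) / 2`; the
  -- factor `N - 2` later cancels against `C(N,3)`.
  have hcount : ∀ i, (∑ S ∈ (Finset.univ : Finset {b // P b}).powersetCard 3,
      if ¬ ∀ x ∈ S, ∀ y ∈ S, x.1 i = y.1 i then (1 : ℝ) else 0) =
        (a i : ℝ) * z i * (N - 2) / 2 := by
    intro i
    rw [← Finset.sum_filter, Finset.sum_const, nsmul_eq_mul, mul_one]
    have h := card_nonconstant_triples (fun b : {b // P b} => b.1 i) (a i) (z i) (ha i) (hz i)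
    have h' := congrArg (Nat.cast : ℕ → ℝ) h
    push_cast [cast_choose_three] at h'
    have hc : (N : ℝ) = a i + z i := by rw [← haz i]; push_cast; ring
    rw [hc]
    linear_combination h'
  unfold avgSteinerDist
  rw [Finset.sum_congr rfl hst, Finset.sum_comm, Finset.sum_congr rfl fun i _ => hcount i, hN,
    cast_choose_three, ← Finset.sum_div, ← Finset.sum_mul]
  have h3' : (3 : ℝ) ≤ N := by exact_mod_cast h3
  have h1 : (N : ℝ) - 1 ≠ 0 := by linarith
  have h2 : (N : ℝ) - 2 ≠ 0 := by linarith
  have h0 : (N : ℝ) ≠ 0 := by linarith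
  field_simp
  ring

/-! ### Closure properties of Fibonacci and Lucas strings -/

theorem isFibonacciString_of_le {n : ℕ} (b c : Fin n → Bool) (hb : IsFibonacciString b)
    (h : ∀ i, c i = true → b i = true) : IsFibonacciString c :=
  fun i j hij hc => hb i j hij ⟨h i hc.1, h j hc.2⟩

theorem isLucasString_of_le {n : ℕ} (b c : Fin n → Bool) (hb : IsLucasString b)
    (h : ∀ i, c i = true → b i = true) : IsLucasString c :=
  ⟨isFibonacciString_of_le b c hb.1 h, fun i j hi hj hc => hb.2 i j hi hj ⟨h i hc.1, h j hc.2⟩⟩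

/-- Pigeonhole: two of the three strings would have a one at `i` and two a one at `j`, so some
string would have both. -/
theorem not_majority_and {n : ℕ} {b c d : Fin n → Bool} {i j : Fin n}
    (hb : ¬ (b i = true ∧ b j = true)) (hc : ¬ (c i = true ∧ c j = true))
    (hd : ¬ (d i = true ∧ d j = true)) :
    ¬ (majority b c d i = true ∧ majority b c d j = true) := by
  unfold majority
  revert hb hc hd
  cases b i <;> cases b j <;> cases c i <;> cases c j <;> cases d i <;> cases d j <;> simp

theorem isFibonacciString_majority {n : ℕ} (b c d : Fin n → Bool) (hb : IsFibonacciString b)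
    (hc : IsFibonacciString c) (hd : IsFibonacciString d) :
    IsFibonacciString (majority b c d) :=
  fun i j hij => not_majority_and (hb i j hij) (hc i j hij) (hd i j hij)

theorem isLucasString_majority {n : ℕ} (b c d : Fin n → Bool) (hb : IsLucasString b)
    (hc : IsLucasString c) (hd : IsLucasString d) : IsLucasString (majority b c d) :=
  ⟨isFibonacciString_majority b c d hb.1 hc.1 hd.1,
    fun i j hi hj => not_majority_and (hb.2 i j hi hj) (hc.2 i j hi hj) (hd.2 i j hi hj)⟩

/-! ### Counting strings with a prescribed entry -/

/-- A Fibonacci string with a zero in position `i` consists of two arbitrary Fibonacci strings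
before and after that position. -/
def fibonacciStringSplit (m k : ℕ) (i : Fin (m + 1 + k)) (hi : (i : ℕ) = m) :
    {b : {b : Fin (m + 1 + k) → Bool // IsFibonacciString b} // b.1 i = false} ≃
      {b : Fin m → Bool // IsFibonacciString b} × {b : Fin k → Bool // IsFibonacciString b} where
  toFun b := (⟨fun j => b.1.1 ⟨j, by omega⟩, fun p q hpq => b.1.2 _ _ hpq⟩,
    ⟨fun j => b.1.1 ⟨m + 1 + j, by omega⟩,
      fun p q hpq => b.1.2 _ _ (by show m + 1 + (p : ℕ) + 1 = m + 1 + q; omega)⟩)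
  invFun u := ⟨⟨fun j => if h : (j : ℕ) < m then u.1.1 ⟨j, h⟩
      else if h' : m < j then u.2.1 ⟨j - m - 1, by omega⟩ else false, by
    intro p q hpq
    by_cases h1 : (q : ℕ) < m
    · have h2 : (p : ℕ) < m := by omega
      simp only [h1, h2, dif_pos]
      exact u.1.2 _ _ hpq
    · by_cases h2 : m < p
      · have h3 : ¬ (p : ℕ) < m := by omega
        have h4 : m < q := by omega
        simp only [h1, h2, h3, h4, dif_pos, dif_neg, not_false_eq_true]
        exact u.2.2 _ _ (by show (p : ℕ) - m - 1 + 1 = q - m - 1; omega)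
      · by_cases h5 : m < q
        · have h3 : ¬ (p : ℕ) < m := by omega
          simp [h2, h3]
        · simp [h1, h5]⟩, by simp [hi]⟩
  left_inv b := by
    apply Subtype.ext
    apply Subtype.ext
    funext j
    by_cases h1 : (j : ℕ) < m
    · simp [h1]
    · by_cases h2 : m < j
      · simp only [h1, h2, dif_pos, dif_neg, not_false_eq_true]
        exact congrArg b.1.1 (Fin.ext (by
          show m + 1 + ((j : ℕ) - m - 1) = j
          omega))
      · have h3 : j = i := Fin.ext (by omega)
        simp only [h1, h2, dif_neg, not_false_eq_true]
        rw [h3, b.2]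
  right_inv u := by
    refine Prod.ext (Subtype.ext (funext fun j => ?_)) (Subtype.ext (funext fun j => ?_))
    · simp
    · have h1 : ¬ m + 1 + (j : ℕ) < m := by omega
      have h2 : m < m + 1 + (j : ℕ) := by omega
      simp only [h1, h2, dif_pos, dif_neg, not_false_eq_true]
      exact congrArg u.2.1 (Fin.ext (by
        show m + 1 + (j : ℕ) - m - 1 = j
        omega))

theorem card_isFibonacciString_false_eq_mul {n : ℕ} (i : Fin n) :
    Fintype.card {b : {b : Fin n → Bool // IsFibonacciString b} // b.1 i = false} =
      Fintype.card {b : Fin i → Bool // IsFibonacciString b} *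
        Fintype.card {b : Fin (n - 1 - i) → Bool // IsFibonacciString b} := by
  obtain ⟨m, hm⟩ : ∃ m, m = (i : ℕ) := ⟨_, rfl⟩
  obtain ⟨k, hk⟩ : ∃ k, k = n - 1 - i := ⟨_, rfl⟩
  obtain rfl : n = m + 1 + k := by omega
  rw [← hk, ← hm, ← Fintype.card_prod]
  exact Fintype.card_congr (fibonacciStringSplit m k i hm.symm)

/-- A Fibonacci string beginning with a one consists of `10` and an arbitrary Fibonacci string. -/
def fibonacciStringHead (n : ℕ) :
    {b : {b : Fin (n + 2) → Bool // IsFibonacciString b} // b.1 0 = true} ≃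
      {b : Fin n → Bool // IsFibonacciString b} where
  toFun b := ⟨fun j => b.1.1 j.succ.succ,
    fun p q hpq => b.1.2 _ _ (by simp only [Fin.val_succ]; omega)⟩
  invFun u := ⟨⟨Fin.cons true (Fin.cons false u.1), by
    intro p q hpq
    induction p using Fin.cases with
    | zero =>
      obtain rfl : q = Fin.succ 0 := Fin.ext (by simpa using hpq.symm)
      simp
    | succ p =>
      induction p using Fin.cases with
      | zero => simp
      | succ p =>
        induction q using Fin.cases with
        | zero => simp at hpq
        | succ q =>
          induction q using Fin.cases with
          | zero => simp
          | succ q =>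
            simp only [Fin.cons_succ]
            exact u.2 _ _ (by simpa using hpq)⟩, rfl⟩
  left_inv b := by
    apply Subtype.ext
    apply Subtype.ext
    funext j
    induction j using Fin.cases with
    | zero => simp [b.2]
    | succ j =>
      induction j using Fin.cases with
      | zero =>
        have := b.1.2 0 (Fin.succ 0) rfl
        rw [b.2] at this
        simpa using this
      | succ j => simp
  right_inv u := by
    apply Subtype.ext
    funext j
    simp

theorem card_isFibonacciString (n : ℕ) :
    Fintype.card {b : Fin n → Bool // IsFibonacciString b} = Nat.fib (n + 2) := by
  induction n using Nat.twoStepInduction with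
  | zero => rfl
  | one => rfl
  | more n ih1 ih2 =>
    rw [← card_true_add_card_false (0 : Fin (n + 2)), card_isFibonacciString_false_eq_mul,
      Fintype.card_congr (fibonacciStringHead n), ih1, Nat.fib_add_two (n := n + 2)]
    congr 1
    have h0 : Fintype.card {b : Fin ((0 : Fin (n + 2)) : ℕ) → Bool // IsFibonacciString b} = 1 :=
      rfl
    rw [h0, one_mul]
    exact ih2

theorem card_isFibonacciString_false {n : ℕ} (i : Fin n) :
    Fintype.card {b : {b : Fin n → Bool // IsFibonacciString b} // b.1 i = false} =
      Nat.fib (i + 2) * Nat.fib (n - i + 1) := by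
  rw [card_isFibonacciString_false_eq_mul, card_isFibonacciString, card_isFibonacciString]
  congr 2
  omega

/-- Obtained by subtracting the strings with a zero from all strings; the addition formula
`Nat.fib_add` makes the difference a product. -/
theorem card_isFibonacciString_true {n : ℕ} (i : Fin n) :
    Fintype.card {b : {b : Fin n → Bool // IsFibonacciString b} // b.1 i = true} =
      Nat.fib (i + 1) * Nat.fib (n - i) := by
  have h := card_true_add_card_false (P := IsFibonacciString) i
  rw [card_isFibonacciString, card_isFibonacciString_false] at h
  have h2 := Nat.fib_add (i + 1) (n - i)
  have e : (i : ℕ) + 1 + (n - i) + 1 = n + 2 := by omega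
  rw [e] at h2
  change _ = _ + Nat.fib (i + 2) * _ at h2
  omega

/-- Addition in `Fin (n + 1)` wraps around, so the condition becomes cyclic and visibly invariant
under rotation. In length one both sides exclude the string `1`. -/
theorem isLucasString_iff {n : ℕ} (b : Fin (n + 1) → Bool) :
    IsLucasString b ↔ ∀ i, ¬ (b i = true ∧ b (i + 1) = true) := by
  constructor
  · intro h i
    by_cases hi : i = Fin.last n
    · subst hi
      rw [Fin.last_add_one]
      exact fun h' => h.2 0 (Fin.last n) rfl rfl ⟨h'.2, h'.1⟩
    · refine h.1 i (i + 1) ?_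
      rw [Fin.val_add_one, if_neg hi]
  · intro h
    refine ⟨fun i j hij => ?_, fun i j hi hj => ?_⟩
    · have : j = i + 1 := Fin.ext (by
        rw [Fin.val_add_one, if_neg, hij]
        rintro rfl
        have := j.2
        simp at hij
        omega)
      exact this ▸ h i
    · obtain rfl : i = 0 := Fin.ext hi
      obtain rfl : j = Fin.last n := Fin.ext (by simpa using hj)
      have := h (Fin.last n)
      rw [Fin.last_add_one] at this
      exact fun h' => this ⟨h'.2, h'.1⟩

/-- Rotating the string by `i` moves position `i` to position `0`. -/
theorem card_isLucasString_eq_zero_index {n : ℕ} (i : Fin (n + 1)) (t : Bool) :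
    Fintype.card {b : {b : Fin (n + 1) → Bool // IsLucasString b} // b.1 i = t} =
      Fintype.card {b : {b : Fin (n + 1) → Bool // IsLucasString b} // b.1 0 = t} := by
  refine Fintype.card_congr (Equiv.subtypeEquiv
    (Equiv.subtypeEquiv ((Equiv.addRight i).arrowCongr (Equiv.refl Bool)).symm fun b => ?_)
    fun b => ?_)
  · rw [isLucasString_iff, isLucasString_iff]
    constructor
    · intro h j
      have := h (j + i)
      rwa [add_right_comm] at this
    · intro h j
      have := h (j - i)
      simpa [add_right_comm (j - i) 1 i] using this
  · simp [Equiv.subtypeEquiv]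

/-- A leading zero makes the condition on the two ends vacuous, so these are the Fibonacci strings
with a leading zero. -/
theorem card_isLucasString_zero_false (n : ℕ) :
    Fintype.card {b : {b : Fin (n + 1) → Bool // IsLucasString b} // b.1 0 = false} =
      Nat.fib (n + 2) := by
  have h := card_isFibonacciString_false (0 : Fin (n + 1))
  have e : Nat.fib (((0 : Fin (n + 1)) : ℕ) + 2) * Nat.fib (n + 1 - ((0 : Fin (n + 1)) : ℕ) + 1) =
      Nat.fib (n + 2) := by simp
  rw [e] at h
  rw [← h]
  refine Fintype.card_congr
    ⟨fun b => ⟨⟨b.1.1, b.1.2.1⟩, b.2⟩, fun b => ⟨⟨b.1.1, b.1.2, fun i j hi _ h' => ?_⟩, b.2⟩,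
      fun _ => rfl, fun _ => rfl⟩
  obtain rfl : i = 0 := Fin.ext hi
  rw [b.2] at h'
  simp at h'

/-- A Lucas string beginning with a one consists of `10`, an arbitrary Fibonacci string, and a
zero at the end. -/
theorem card_isLucasString_zero_true (n : ℕ) :
    Fintype.card {b : {b : Fin (n + 3) → Bool // IsLucasString b} // b.1 0 = true} =
      Nat.fib (n + 2) := by
  have h := card_isFibonacciString_false (Fin.last n)
  have e : Nat.fib (((Fin.last n : Fin (n + 1)) : ℕ) + 2) *
      Nat.fib (n + 1 - ((Fin.last n : Fin (n + 1)) : ℕ) + 1) = Nat.fib (n + 2) := by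
    simp
  rw [e] at h
  rw [← h]
  let F := fibonacciStringHead (n + 1)
  refine Fintype.card_congr
    ⟨fun b => ⟨F ⟨⟨b.1.1, b.1.2.1⟩, b.2⟩, ?_⟩,
      fun u => ⟨⟨(F.symm u.1).1.1, (F.symm u.1).1.2, fun i j _ hj h' => ?_⟩, (F.symm u.1).2⟩,
      fun b => ?_, fun u => ?_⟩
  · have := b.1.2.2 0 (Fin.last n).succ.succ rfl rfl
    rw [b.2] at this
    exact Bool.eq_false_iff.mpr fun h' => this ⟨rfl, h'⟩
  · obtain rfl : j = (Fin.last n).succ.succ := Fin.ext (by simp; omega)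
    have h1 : (F.symm u.1).1.1 (Fin.last n).succ.succ = (F (F.symm u.1)).1 (Fin.last n) := rfl
    rw [h1, Equiv.apply_symm_apply, u.2] at h'
    simp at h'
  · apply Subtype.ext
    apply Subtype.ext
    simp
  · apply Subtype.ext
    simp

/-! ### Exact formulas for the average distances -/

theorem avgSteinerDist_fibonacciCube {n : ℕ} (hn : 2 ≤ n) :
    avgSteinerDist 3 (fibonacciCube n) =
      3 * (∑ i ∈ Finset.range n, (Nat.fib (i + 1) : ℝ) * Nat.fib (i + 2) *
        (Nat.fib (n - i) * Nat.fib (n - i + 1))) / (Nat.fib (n + 2) * (Nat.fib (n + 2) - 1)) := by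
  have h3 : 3 ≤ Nat.fib (n + 2) := Nat.fib_mono (by omega : 4 ≤ n + 2)
  rw [avgSteinerDist_three isFibonacciString_of_le isFibonacciString_majority
    (fun _ _ => Iff.rfl) (card_isFibonacciString n) h3 _ _ card_isFibonacciString_true
    card_isFibonacciString_false, ← Fin.sum_univ_eq_sum_range fun i =>
      (Nat.fib (i + 1) : ℝ) * Nat.fib (i + 2) * (Nat.fib (n - i) * Nat.fib (n - i + 1))]
  congr 2
  refine Finset.sum_congr rfl fun i _ => ?_
  push_cast
  ring

theorem avgSteinerDist_lucasCube (n : ℕ) :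
    avgSteinerDist 3 (lucasCube (n + 3)) =
      3 * ((n + 3 : ℕ) * ((Nat.fib (n + 2) : ℝ) * Nat.fib (n + 4))) /
        ((Nat.fib (n + 2) + Nat.fib (n + 4)) * (Nat.fib (n + 2) + Nat.fib (n + 4) - 1)) := by
  have ha : ∀ i, Fintype.card {b : {b : Fin (n + 3) → Bool // IsLucasString b} // b.1 i = true} =
      Nat.fib (n + 2) := fun i => by
    rw [card_isLucasString_eq_zero_index, card_isLucasString_zero_true]
  have hz : ∀ i, Fintype.card {b : {b : Fin (n + 3) → Bool // IsLucasString b} // b.1 i = false} =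
      Nat.fib (n + 4) := fun i => by
    rw [card_isLucasString_eq_zero_index, card_isLucasString_zero_false]
  have hN := card_true_add_card_false (P := IsLucasString) (0 : Fin (n + 3))
  rw [ha, hz] at hN
  have h3 : 3 ≤ Nat.fib (n + 2) + Nat.fib (n + 4) :=
    (Nat.fib_mono (by omega : 4 ≤ n + 4)).trans (Nat.le_add_left _ _)
  rw [avgSteinerDist_three isLucasString_of_le isLucasString_majority
    (fun _ _ => Iff.rfl) hN.symm h3 _ _ ha hz]
  simp

/-! ### Asymptotics -/

theorem fib_mul_fib_succ (k : ℕ) :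
    (Nat.fib k : ℝ) * Nat.fib (k + 1) =
      (Real.goldenRatio ^ (2 * k + 1) + Real.goldenConj ^ (2 * k + 1) - (-1) ^ k) / 5 := by
  have h5 : √(5 : ℝ) * √5 = 5 := Real.mul_self_sqrt (by norm_num)
  rw [Real.coe_fib_eq, Real.coe_fib_eq, div_mul_div_comm, h5, ← Real.goldenRatio_mul_goldenConj,
    mul_pow]
  congr 1
  linear_combination
    -(Real.goldenRatio ^ k * Real.goldenConj ^ k) * Real.goldenRatio_add_goldenConj

theorem abs_goldenConj_le_one : |Real.goldenConj| ≤ 1 :=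
  abs_le.mpr ⟨Real.neg_one_lt_goldenConj.le, Real.goldenConj_neg.le.trans zero_le_one⟩

theorem abs_fib_mul_fib_succ_sub_le (k : ℕ) :
    |(Nat.fib k : ℝ) * Nat.fib (k + 1) - Real.goldenRatio ^ (2 * k + 1) / 5| ≤ 2 / 5 := by
  have h1 : |Real.goldenConj ^ (2 * k + 1)| ≤ 1 := by
    rw [abs_pow]
    exact pow_le_one₀ (abs_nonneg _) abs_goldenConj_le_one
  have h2 : |(-1 : ℝ) ^ k| ≤ 1 := by simp
  rw [fib_mul_fib_succ]
  rw [abs_le] at h1 h2 ⊢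
  constructor <;> linarith

/-- The geometric sum has denominator `φ² - 1 = φ > 1`. -/
theorem sum_sq_goldenRatio_pow_le (n : ℕ) :
    ∑ i ∈ Finset.range n, (Real.goldenRatio ^ 2) ^ i ≤ (Real.goldenRatio ^ 2) ^ n := by
  have h := mul_geom_sum (Real.goldenRatio ^ 2) n
  rw [Real.goldenRatio_sq, add_sub_cancel_right, ← Real.goldenRatio_sq] at h
  have h0 : 0 ≤ ∑ i ∈ Finset.range n, (Real.goldenRatio ^ 2) ^ i :=
    Finset.sum_nonneg fun i _ => by positivity
  nlinarith [Real.one_lt_goldenRatio]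

/-- The leading parts of the two factors multiply to `φ ^ (2n + 4) / 25`, whatever `i` is. The
errors sum geometrically to the order of a single term, which is negligible against `n` terms. -/
theorem abs_sum_fib_products_sub_le (n : ℕ) :
    |∑ i ∈ Finset.range n, (Nat.fib (i + 1) : ℝ) * Nat.fib (i + 2) *
        (Nat.fib (n - i) * Nat.fib (n - i + 1)) - n * (Real.goldenRatio ^ (2 * n + 4) / 25)| ≤
      2 * Real.goldenRatio ^ (2 * n + 4) := by
  set φ := Real.goldenRatio
  have hφ : 1 < φ := Real.one_lt_goldenRatio
  have hterm : ∀ i ∈ Finset.range n, |(Nat.fib (i + 1) : ℝ) * Nat.fib (i + 2) *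
        (Nat.fib (n - i) * Nat.fib (n - i + 1)) - φ ^ (2 * n + 4) / 25| ≤
      φ ^ 3 * (φ ^ 2) ^ i + φ ^ 3 * (φ ^ 2) ^ (n - 1 - i) := by
    intro i hi
    have hi := Finset.mem_range.mp hi
    have h1 := abs_fib_mul_fib_succ_sub_le (i + 1)
    have h2 := abs_fib_mul_fib_succ_sub_le (n - i)
    have e1 : φ ^ (2 * (i + 1) + 1) = φ ^ 3 * (φ ^ 2) ^ i := by
      rw [← pow_mul, ← pow_add]
      congr 1
      omega
    have e2 : φ ^ (2 * (n - i) + 1) = φ ^ 3 * (φ ^ 2) ^ (n - 1 - i) := by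
      rw [← pow_mul, ← pow_add]
      congr 1
      omega
    have e3 : φ ^ (2 * n + 4) = φ ^ (2 * (i + 1) + 1) * φ ^ (2 * (n - i) + 1) := by
      rw [← pow_add]
      congr 1
      omega
    rw [e3, e1, e2]
    change |_ - φ ^ (2 * (i + 1) + 1) / 5| ≤ _ at h1
    change |_ - φ ^ (2 * (n - i) + 1) / 5| ≤ _ at h2
    rw [e1] at h1
    rw [e2] at h2
    have hx : 1 ≤ φ ^ 3 * (φ ^ 2) ^ i := by
      rw [← e1]; exact one_le_pow₀ hφ.le
    have hy : 1 ≤ φ ^ 3 * (φ ^ 2) ^ (n - 1 - i) := by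
      rw [← e2]; exact one_le_pow₀ hφ.le
    generalize φ ^ 3 * (φ ^ 2) ^ i = x at *
    generalize φ ^ 3 * (φ ^ 2) ^ (n - 1 - i) = y at *
    generalize (Nat.fib (n - i) : ℝ) * Nat.fib (n - i + 1) = v at *
    change |(Nat.fib (i + 1) : ℝ) * Nat.fib (i + 2) - _| ≤ _ at h1
    generalize (Nat.fib (i + 1) : ℝ) * Nat.fib (i + 2) = u at *
    -- With both errors at most `2/5`, this is at most `(4 + 2x + 2y) / 25`, which is below `x + y`
    -- because `x, y ≥ 1`.
    have hs : u * v - x * y / 25 =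
        (u - x / 5) * (v - y / 5) + (u - x / 5) * (y / 5) + x / 5 * (v - y / 5) := by ring
    rw [hs]
    refine (abs_add_three _ _ _).trans ?_
    rw [abs_mul, abs_mul, abs_mul, abs_of_nonneg (by linarith : 0 ≤ x / 5),
      abs_of_nonneg (by linarith : 0 ≤ y / 5)]
    have b1 : |u - x / 5| * |v - y / 5| ≤ 2 / 5 * (2 / 5) :=
      mul_le_mul h1 h2 (abs_nonneg _) (by norm_num)
    have b2 : |u - x / 5| * (y / 5) ≤ 2 / 5 * (y / 5) :=
      mul_le_mul_of_nonneg_right h1 (by linarith)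
    have b3 : x / 5 * |v - y / 5| ≤ x / 5 * (2 / 5) :=
      mul_le_mul_of_nonneg_left h2 (by linarith)
    linarith
  have hsub : ∑ i ∈ Finset.range n, (Nat.fib (i + 1) : ℝ) * Nat.fib (i + 2) *
        (Nat.fib (n - i) * Nat.fib (n - i + 1)) - n * (φ ^ (2 * n + 4) / 25) =
      ∑ i ∈ Finset.range n, ((Nat.fib (i + 1) : ℝ) * Nat.fib (i + 2) *
        (Nat.fib (n - i) * Nat.fib (n - i + 1)) - φ ^ (2 * n + 4) / 25) := by
    rw [Finset.sum_sub_distrib, Finset.sum_const, Finset.card_range, nsmul_eq_mul]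
  rw [hsub]
  refine (Finset.abs_sum_le_sum_abs _ _).trans ((Finset.sum_le_sum hterm).trans ?_)
  rw [Finset.sum_add_distrib, Finset.sum_range_reflect (fun i => φ ^ 3 * (φ ^ 2) ^ i) n,
    ← Finset.mul_sum, ← two_mul]
  have h := sum_sq_goldenRatio_pow_le n
  change _ ≤ (φ ^ 2) ^ n at h
  have e : φ ^ (2 * n + 4) = φ * (φ ^ 3 * (φ ^ 2) ^ n) := by
    rw [← pow_mul, ← pow_add, ← pow_succ']
    congr 1
    omega
  have hp : 0 ≤ φ ^ 3 := by positivity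
  have hq : 0 ≤ φ ^ 3 * (φ ^ 2) ^ n := by positivity
  rw [e]
  nlinarith [mul_le_mul_of_nonneg_left h hp]

theorem tendsto_sum_fib_products_div :
    Tendsto (fun n : ℕ => (∑ i ∈ Finset.range n, (Nat.fib (i + 1) : ℝ) * Nat.fib (i + 2) *
        (Nat.fib (n - i) * Nat.fib (n - i + 1))) / (n * Real.goldenRatio ^ (2 * n + 4)))
      atTop (𝓝 (1 / 25)) := by
  rw [tendsto_iff_dist_tendsto_zero]
  refine squeeze_zero' (Eventually.of_forall fun _ => dist_nonneg) ?_
    (tendsto_const_div_atTop_nhds_zero_nat 2)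
  filter_upwards [eventually_gt_atTop 0] with n hn
  have hn' : (0 : ℝ) < n := by exact_mod_cast hn
  have h := abs_sum_fib_products_sub_le n
  set X := Real.goldenRatio ^ (2 * n + 4)
  have hX : 0 < X := pow_pos Real.goldenRatio_pos _
  rw [Real.dist_eq, le_div_iff₀ hn']
  set S := ∑ i ∈ Finset.range n, (Nat.fib (i + 1) : ℝ) * Nat.fib (i + 2) *
        (Nat.fib (n - i) * Nat.fib (n - i + 1))
  have e : S / (n * X) - 1 / 25 = (S - n * (X / 25)) / (n * X) := by
    field_simp
  rw [e, abs_div, abs_of_pos (by positivity : 0 < n * X), div_mul_eq_mul_div,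
    div_le_iff₀ (by positivity)]
  nlinarith

theorem tendsto_fib_div_goldenRatio_pow :
    Tendsto (fun n : ℕ => (Nat.fib n : ℝ) / Real.goldenRatio ^ n) atTop (𝓝 (1 / √5)) := by
  have h₂ := tendsto_pow_atTop_nhds_zero_of_abs_lt_one
    (r := Real.goldenConj / Real.goldenRatio) <| by
      rw [abs_div, div_lt_one (abs_pos.mpr Real.goldenRatio_ne_zero),
        abs_of_pos Real.goldenRatio_pos]
      exact abs_goldenConj_le_one.trans_lt Real.one_lt_goldenRatio
  have h := (h₂.const_sub 1).div_const √5
  rw [sub_zero] at h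
  refine h.congr fun n => ?_
  have := pow_ne_zero n Real.goldenRatio_ne_zero
  rw [Real.coe_fib_eq, div_pow]
  field_simp

theorem tendsto_inv_goldenRatio_pow :
    Tendsto (fun n : ℕ => 1 / Real.goldenRatio ^ n) atTop (𝓝 0) := by
  have h := tendsto_pow_atTop_nhds_zero_of_lt_one (r := 1 / Real.goldenRatio)
    (one_div_nonneg.mpr Real.goldenRatio_pos.le)
    ((div_lt_one Real.goldenRatio_pos).mpr Real.one_lt_goldenRatio)
  simpa [div_pow] using h

theorem tendsto_fibonacci_average :
    Tendsto (fun n : ℕ => 3 * (∑ i ∈ Finset.range n, (Nat.fib (i + 1) : ℝ) * Nat.fib (i + 2) *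
        (Nat.fib (n - i) * Nat.fib (n - i + 1))) /
        (Nat.fib (n + 2) * (Nat.fib (n + 2) - 1)) / n) atTop (𝓝 (3 / 5)) := by
  have h1 := tendsto_fib_div_goldenRatio_pow.comp (tendsto_add_atTop_nat 2)
  have h2 := tendsto_inv_goldenRatio_pow.comp (tendsto_add_atTop_nat 2)
  have h5 : √(5 : ℝ) ^ 2 = 5 := Real.sq_sqrt (by norm_num)
  have h := (tendsto_sum_fib_products_div.const_mul 3).div (h1.mul (h1.sub h2)) (by simp)
  have e : 3 * (1 / 25) / (1 / √(5 : ℝ) * (1 / √5 - 0)) = 3 / 5 := by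
    rw [sub_zero, ← pow_two, div_pow, h5]
    norm_num
  rw [e] at h
  refine h.congr fun n => ?_
  have hφ := Real.goldenRatio_ne_zero
  have hX := pow_ne_zero (n + 2) hφ
  have e2 : Real.goldenRatio ^ (2 * n + 4) =
    Real.goldenRatio ^ (n + 2) * Real.goldenRatio ^ (n + 2) := by
    rw [← pow_add]
    congr 1
    omega
  simp only [Function.comp, Pi.div_apply]
  rw [e2, ← sub_div, div_mul_div_comm, mul_div_assoc', div_div_div_eq]
  generalize Real.goldenRatio ^ (n + 2) = X at *
  rw [div_div, mul_comm (n : ℝ) (X * X), mul_assoc (X * X), mul_comm _ (X * X),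
    mul_div_mul_left _ _ (mul_ne_zero hX hX), mul_comm (n : ℝ)]

theorem tendsto_lucas_average :
    Tendsto (fun n : ℕ => 3 * ((n + 3 : ℕ) * ((Nat.fib (n + 2) : ℝ) * Nat.fib (n + 4))) /
        ((Nat.fib (n + 2) + Nat.fib (n + 4)) * (Nat.fib (n + 2) + Nat.fib (n + 4) - 1)) /
          (n + 3 : ℕ)) atTop (𝓝 (3 / 5)) := by
  have h1 := tendsto_fib_div_goldenRatio_pow.comp (tendsto_add_atTop_nat 2)
  have h2 := tendsto_inv_goldenRatio_pow.comp (tendsto_add_atTop_nat 2)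
  have h3 := (tendsto_fib_div_goldenRatio_pow.comp (tendsto_add_atTop_nat 4)).mul_const
    (Real.goldenRatio ^ 2)
  have h5 : √(5 : ℝ) ^ 2 = 5 := Real.sq_sqrt (by norm_num)
  have h50 : √(5 : ℝ) ≠ 0 := by positivity
  have hφ0 := Real.goldenRatio_pos
  have hne : (1 / √5 + 1 / √5 * Real.goldenRatio ^ 2) *
      (1 / √5 + 1 / √5 * Real.goldenRatio ^ 2 - 0) ≠ 0 := by
    rw [sub_zero]; positivity
  have h := ((h1.mul h3).const_mul 3).div ((h1.add h3).mul ((h1.add h3).sub h2)) hne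
  -- The value is `3φ² / (1 + φ²)²`, and `φ² = φ + 1` gives `(1 + φ²)² = (φ + 2)² = 5φ²`.
  have e : 3 * (1 / √5 * (1 / √5 * Real.goldenRatio ^ 2)) /
      ((1 / √5 + 1 / √5 * Real.goldenRatio ^ 2) *
      (1 / √5 + 1 / √5 * Real.goldenRatio ^ 2 - 0)) = 3 / 5 := by
    have hs := Real.goldenRatio_sq
    rw [div_eq_div_iff hne (by norm_num), sub_zero, hs]
    generalize Real.goldenRatio = φ at hs ⊢
    linear_combination (-3 * (1 / √5) ^ 2) * hs
  rw [e] at h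
  refine h.congr fun n => ?_
  have hX := pow_ne_zero (n + 2) hφ0.ne'
  have e2 : Real.goldenRatio ^ (n + 4) = Real.goldenRatio ^ (n + 2) * Real.goldenRatio ^ 2 := by
    rw [← pow_add]
  have e3 : (Nat.fib (n + 4) : ℝ) / Real.goldenRatio ^ (n + 4) * Real.goldenRatio ^ 2 =
      Nat.fib (n + 4) / Real.goldenRatio ^ (n + 2) := by
    rw [e2]
    field_simp
  have hn : ((n + 3 : ℕ) : ℝ) ≠ 0 := by positivity
  simp only [Function.comp, Pi.div_apply]
  rw [e3]
  generalize Real.goldenRatio ^ (n + 2) = X at *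
  rw [div_div, mul_comm _ ((n + 3 : ℕ) : ℝ), mul_left_comm (3 : ℝ) ((n + 3 : ℕ) : ℝ),
    mul_div_mul_left _ _ hn,
    ← add_div, ← sub_div, div_mul_div_comm, div_mul_div_comm, mul_div_assoc',
    div_div_div_cancel_right₀ (mul_ne_zero hX hX)]

theorem mainTheorem4 :
    Tendsto (fun n : ℕ => avgSteinerDist 3 (fibonacciCube n) / (n : ℝ)) atTop (𝓝 (3 / 5)) ∧
    Tendsto (fun n : ℕ => avgSteinerDist 3 (lucasCube n) / (n : ℝ)) atTop (𝓝 (3 / 5)) := by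
  constructor
  · refine tendsto_fibonacci_average.congr' ?_
    filter_upwards [eventually_ge_atTop 2] with n hn
    rw [avgSteinerDist_fibonacciCube hn]
  -- The Lucas count with a leading one presupposes length at least three.
  · rw [← tendsto_add_atTop_iff_nat 3]
    refine tendsto_lucas_average.congr fun n => ?_
    rw [avgSteinerDist_lucasCube]
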